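/- Let $d\ge 1$, let $A$ be a complex $d\times d$ matrix, let $S\mathbb C^d$ be the unit sphere of $\mathbb C^d$, and let $f_A:S\mathbb C^d\to\mathbb C$, $f_A(x)=\langle x, Ax\rangle$, be the numerical range map, whose image is the numerical range $W$ of $A$; write $f_A^{-1}(z)=\{x\in S\mathbb C^d: f_A(x)=z\}$. For a non-empty compact convex set $K\subset\mathbb C$ and $u\in\mathbb C$ put $\mathbf h_K(u)=\min_{x\in K}\operatorname{Re}(\bar x u)$ and $F_K(u)=\operatorname{argmin}_{x\in K}\operatorname{Re}(\bar x u)$, and for $|u|=1$ let \[ x_{K,\pm}(u)=u\cdot\bigl[\mathbf h_K(u)\pm \mathrm i\,\mathbf h_{F_K(u)}(\pm \mathrm i u)\bigr], \] which are the endpoints (possibly equal) of the exposed face $F_K(u)$. Let $\psi_1(\theta),\dots,\psi_d(\theta)$, $\theta\in\mathbb R$, be a real-analytic curve of orthonormal bases of $\mathbb C^d$ consisting of eigenvectors of $\operatorname{Re}(e^{-\mathrm i\theta}A)$, where $\operatorname{Re}B=\tfrac12(B+B^*)$, and let $z_k(\theta)=f_A(\psi_k(\theta))$. For $z\in\mathbb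 C$ and $\theta\in\mathbb R$ let \[ X_A(z,\theta)=\operatorname{span}\{\psi_k(\theta): k\in\{1,\dots,d\},\ z_k(\theta)=z\}, \] and let $p_A(z,\theta)$ be the matrix of the orthogonal projection of $\mathbb C^d$ onto $X_A(z,\theta)$. Let $\mathcal M_d$ be the set of positive semi-definite complex $d\times d$ matrices of trace one, let $S(\rho)=-\operatorname{tr}\rho\log\rho$ be the von Neumann entropy (with $0\log 0=0$), and let \[ \rho_A^*(z)=\operatorname{argmax}\{S(\rho):\rho\in\mathcal M_d,\ \operatorname{tr}(\rho A)=z\},\qquad z\in W, \] be the MaxEnt map. Then for every $\theta\in\mathbb R$ and for each of the two points $z=x_{W,+}(e^{\mathrm i\theta})$ and $z=x_{W,-}(e^{\mathrm i\theta})$, \[ f_A^{-1}(z)=S\mathbb C^d\cap X_A(z,\theta), \] the maximizer defining $\rho_A^*(z)$ exists and is unique, and \[ \rho_A^*(z)=\frac{p_A(z,\theta)}{\operatorname{tr}p_A(z,\theta)} . \] -/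

import Mathlib

noncomputable section

open scoped ComplexOrder

namespace MaxEntNR

/-! ### Support function and extreme points of planar convex bodies -/

/-- The support function `h_K(u) = min_{x ∈ K} ⟨x, u⟩` of `K ⊆ ℂ`, where
`⟨x, u⟩ = Re (conj x * u)` is the Euclidean scalar product of `ℂ ≅ ℝ²`. For a convex body (compact
and non-empty) the infimum is a minimum. -/
def supportFun (K : Set ℂ) (u : ℂ) : ℝ :=
  sInf ((fun x : ℂ => inner ℝ x u) '' K)

/-- The exposed face `F_K(u) = argmin_{x ∈ K} ⟨x, u⟩`. -/
def exposedFace (K : Set ℂ) (u : ℂ) : Set ℂ :=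
  {x ∈ K | ∀ y ∈ K, inner ℝ x u ≤ inner ℝ y u}

/-- `x_{K,+}(u) = u (h_K(u) + i h_{F_K(u)}(i u))`. -/
def xPlus (K : Set ℂ) (u : ℂ) : ℂ :=
  u * ((supportFun K u : ℂ) +
    Complex.I * (supportFun (exposedFace K u) (Complex.I * u) : ℂ))

/-- `x_{K,-}(u) = u (h_K(u) - i h_{F_K(u)}(-i u))`. -/
def xMinus (K : Set ℂ) (u : ℂ) : ℂ :=
  u * ((supportFun K u : ℂ) -
    Complex.I * (supportFun (exposedFace K u) (-(Complex.I * u)) : ℂ))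

variable {d : ℕ}

/-! ### The numerical range -/

/-- The quadratic form `x ↦ ⟨x, A x⟩`; its restriction to the unit sphere is the numerical range
map `f_A`. -/
def nrMap (A : Matrix (Fin d) (Fin d) ℂ) (x : EuclideanSpace ℂ (Fin d)) : ℂ :=
  inner ℂ x (Matrix.toEuclideanCLM (n := Fin d) (𝕜 := ℂ) A x)

/-- The numerical range `W_A`, the image of the unit sphere under `f_A`. -/
def numRange (A : Matrix (Fin d) (Fin d) ℂ) : Set ℂ :=
  nrMap A '' Metric.sphere 0 1

/-- The multi-valued inverse `f_A⁻¹` of the numerical range map `f_A` on the unit sphere. -/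
def nrInv (A : Matrix (Fin d) (Fin d) ℂ) (z : ℂ) : Set (EuclideanSpace ℂ (Fin d)) :=
  {x ∈ Metric.sphere 0 1 | nrMap A x = z}

/-! ### Analytic eigenvectors -/

/-- The hermitian matrix `Re (e^{-iθ} A)`, where `Re B = (B + B*) / 2`. -/
def rotRe (A : Matrix (Fin d) (Fin d) ℂ) (θ : ℝ) : Matrix (Fin d) (Fin d) ℂ :=
  (realPart (Complex.exp (-(Complex.I * θ)) • A) : Matrix (Fin d) (Fin d) ℂ)

/-- `ψ_1(θ), …, ψ_d(θ)`, `θ ∈ ℝ`, is an analytic curve of orthonormal bases of `ℂ^d` consisting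
of eigenvectors of `Re (e^{-iθ} A)`. -/
structure IsAnalyticEigenbasis (A : Matrix (Fin d) (Fin d) ℂ)
    (ψ : Fin d → ℝ → EuclideanSpace ℂ (Fin d)) : Prop where
  analytic : ∀ k θ, AnalyticAt ℝ (ψ k) θ
  orthonormal : ∀ θ, Orthonormal ℂ (fun k => ψ k θ)
  eigen : ∀ k θ, ∃ μ : ℝ,
    Matrix.toEuclideanCLM (n := Fin d) (𝕜 := ℂ) (rotRe A θ) (ψ k θ) = (μ : ℂ) • ψ k θ

/-- The curve `z_k(θ) = f_A(ψ_k(θ))`. -/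
def zCurve (A : Matrix (Fin d) (Fin d) ℂ) (ψ : Fin d → ℝ → EuclideanSpace ℂ (Fin d))
    (k : Fin d) (θ : ℝ) : ℂ :=
  nrMap A (ψ k θ)

/-- The index set `K_A(z, θ) = {k : z = z_k(θ)}`. -/
def indexSet (A : Matrix (Fin d) (Fin d) ℂ) (ψ : Fin d → ℝ → EuclideanSpace ℂ (Fin d))
    (z : ℂ) (θ : ℝ) : Set (Fin d) :=
  {k | z = zCurve A ψ k θ}

/-- The subspace `X_A(z, θ)` spanned by the `ψ_k(θ)` with `k ∈ K_A(z, θ)`. -/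
def eigSpan (A : Matrix (Fin d) (Fin d) ℂ) (ψ : Fin d → ℝ → EuclideanSpace ℂ (Fin d))
    (z : ℂ) (θ : ℝ) : Submodule ℂ (EuclideanSpace ℂ (Fin d)) :=
  Submodule.span ℂ ((fun k => ψ k θ) '' indexSet A ψ z θ)

/-- The matrix `p_A(z, θ)` of the orthogonal projection of `ℂ^d` onto `X_A(z, θ)`. -/
def projMat (A : Matrix (Fin d) (Fin d) ℂ) (ψ : Fin d → ℝ → EuclideanSpace ℂ (Fin d))
    (z : ℂ) (θ : ℝ) : Matrix (Fin d) (Fin d) ℂ :=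
  (Matrix.toEuclideanCLM (n := Fin d) (𝕜 := ℂ)).symm (eigSpan A ψ z θ).starProjection

/-! ### The maximum-entropy inference map -/

/-- The state space: positive semi-definite matrices of trace one. -/
def stateSpace (d : ℕ) : Set (Matrix (Fin d) (Fin d) ℂ) :=
  {ρ | ρ.PosSemidef ∧ ρ.trace = 1}

/-- The von Neumann entropy `S(ρ) = -tr (ρ log ρ)`, by functional calculus. Since
`Real.log 0 = 0`, the convention `0 log 0 = 0` holds. -/
def entropy (ρ : Matrix (Fin d) (Fin d) ℂ) : ℝ :=
  -(ρ * cfc Real.log ρ).trace.re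

/-- The states `ρ` with `tr (ρ A) = z`. -/
def stateFiber (A : Matrix (Fin d) (Fin d) ℂ) (z : ℂ) : Set (Matrix (Fin d) (Fin d) ℂ) :=
  {ρ ∈ stateSpace d | (ρ * A).trace = z}

/-- `argmax {S(ρ) : ρ a state, tr (ρ A) = z}` as a set. -/
def maxEntSet (A : Matrix (Fin d) (Fin d) ℂ) (z : ℂ) : Set (Matrix (Fin d) (Fin d) ℂ) :=
  {ρ ∈ stateFiber A z | ∀ σ ∈ stateFiber A z, entropy σ ≤ entropy ρ}

/-- The value `ρ_A^*(z)` of the MaxEnt map: a maximizer of the entropy, which is meaningful where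
`maxEntSet A z` is a singleton. -/
def maxEntMap (A : Matrix (Fin d) (Fin d) ℂ) (z : ℂ) : Matrix (Fin d) (Fin d) ℂ :=
  Classical.epsilon fun ρ => ρ ∈ maxEntSet A z

end MaxEntNR

end

open scoped ComplexOrder

namespace MaxEntNR
open Matrix

variable {d : ℕ}

/-! Write the matrix of `A` in the basis `ψ_k(θ)` as `N`, and put `u = e^{iθ}`. The matrix `Re (conj
u N)` is diagonal, with the eigenvalues `l k` as entries. Differentiating the orthogonality
relations along the analytic curve shows that `N` itself is diagonal on each level set of `l`
(`inner_opr_eq_zero`).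

For a state `R` this turns reaching an endpoint into two successive weighted minimizations. The
`u`-coordinate of `tr (R N)` is the average of the `l k` with weights `R k k`, so minimality kills
the weights off the lowest level. There `tr (R N)` is the average of the `N k k`, and minimality
along the face kills every weight with `N k k ≠ z` (`exists_endpoint`). By positivity, a vanishing
diagonal entry kills its row and column, so every state representing `z` is supported by `p_A(z, θ)`
(`mul_projMat_eq`).

Pure states then give the preimage of `z`. The normalized projection also represents `z`, and it is
the unique state of largest entropy supported by the projection (`entropy_le_log_rank`). -/

/-- A vanishing diagonal entry of a positive semi-definite matrix annihilates its column. -/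
theorem posSemidef_col_eq_zero {ι : Type*} [Fintype ι] [DecidableEq ι] {R : Matrix ι ι ℂ}
    (hR : R.PosSemidef) {k : ι} (hk : R k k = 0) (j : ι) : R j k = 0 := by
  have h := (hR.dotProduct_mulVec_zero_iff (Pi.single k 1)).1 (by simp [hk])
  simpa using congrFun h j

/-! ### Entropy of states supported by a projection -/

theorem entropy_eq_sum {d : ℕ} {ρ : Matrix (Fin d) (Fin d) ℂ} (hρ : ρ.IsHermitian) :
    entropy ρ = ∑ i, Real.negMulLog (hρ.eigenvalues i) := by
  have h : ρ * cfc Real.log ρ = Unitary.conjStarAlgAut ℂ _ hρ.eigenvectorUnitary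
      (diagonal fun i => ((hρ.eigenvalues i * Real.log (hρ.eigenvalues i) : ℝ) : ℂ)) := by
    rw [hρ.cfc_eq, IsHermitian.cfc]
    conv_lhs => lhs; rw [hρ.spectral_theorem]
    rw [← map_mul, diagonal_mul_diagonal]
    simp
  rw [entropy, h, Unitary.conjStarAlgAut_apply, trace_mul_cycle, Unitary.coe_star_mul_self,
    one_mul, trace_diagonal]
  simp only [← Complex.ofReal_sum, Complex.ofReal_re, Real.negMulLog, neg_mul,
    Finset.sum_neg_distrib]

/-- The right-hand side is the tangent line at `n⁻¹` of the strictly concave function `-x log x`;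
the proof is `log t < t - 1` at `t = (n x)⁻¹`. -/
theorem negMulLog_lt {n x : ℝ} (hn : 0 < n) (hx : 0 < x) (h : x ≠ n⁻¹) :
    Real.negMulLog x < x * Real.log n + n⁻¹ - x := by
  have hne : (n * x)⁻¹ ≠ 1 := by
    intro e
    apply h
    rw [inv_eq_one] at e
    field_simp
    linarith
  have h1 := mul_lt_mul_of_pos_left (Real.log_lt_sub_one_of_pos (by positivity) hne) hx
  rw [Real.log_inv, Real.log_mul hn.ne' hx.ne'] at h1
  have h2 : x * ((n * x)⁻¹ - 1) = n⁻¹ - x := by field_simp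
  rw [h2] at h1
  rw [Real.negMulLog]
  linarith

theorem negMulLog_inv {n : ℝ} : Real.negMulLog n⁻¹ = n⁻¹ * Real.log n := by
  rw [Real.negMulLog, Real.log_inv]; ring

/-- The entropy of the normalized projection of rank `n` is `log n`. -/
theorem entropy_smul_projection {d : ℕ} {p : Matrix (Fin d) (Fin d) ℂ} (hp : p.IsHermitian)
    (hpp : p * p = p) {n : ℝ} (hn : 0 < n) (htr : p.trace = n) :
    entropy ((n : ℂ)⁻¹ • p) = Real.log n := by
  have hn' : (n : ℂ) ≠ 0 := by exact_mod_cast hn.ne'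
  set σ := (n : ℂ)⁻¹ • p with hσ
  have hH : σ.IsHermitian := by
    rw [IsHermitian, hσ, conjTranspose_smul, hp.eq]
    simp
  have htr1 : σ.trace = 1 := by rw [hσ, trace_smul, htr, smul_eq_mul, inv_mul_cancel₀ hn']
  have hsq : σ * σ = (n : ℂ)⁻¹ • σ := by rw [hσ, smul_mul_smul_comm, hpp, smul_smul]
  -- The relation `σ² = n⁻¹ σ` forces each eigenvalue to be `0` or `n⁻¹`, and at both values `-x log
  -- x = x log n`.
  have hev : ∀ i, Real.negMulLog (hH.eigenvalues i) = hH.eigenvalues i * Real.log n := by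
    intro i
    have h1 := hH.mulVec_eigenvectorBasis i
    have h2 : (hH.eigenvalues i * hH.eigenvalues i) • (hH.eigenvectorBasis i).ofLp
        = (n⁻¹ * hH.eigenvalues i) • (hH.eigenvectorBasis i).ofLp := by
      have h3 := congrArg (fun M => M *ᵥ (hH.eigenvectorBasis i).ofLp) hsq
      simp only [← mulVec_mulVec, smul_mulVec, h1, mulVec_smul] at h3
      rw [mul_smul, h3, mul_smul, ← Complex.ofReal_inv, Complex.coe_smul]
    have hne : (hH.eigenvectorBasis i).ofLp ≠ 0 := by
      intro e
      apply hH.eigenvectorBasis.orthonormal.ne_zero i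
      ext j
      exact congrFun e j
    have h4 := smul_left_injective ℝ hne h2
    rcases eq_or_ne (hH.eigenvalues i) 0 with h0 | h0
    · simp [h0]
    · rw [mul_right_cancel₀ h0 h4, negMulLog_inv]
  rw [entropy_eq_sum hH, Finset.sum_congr rfl fun i _ => hev i, ← Finset.sum_mul]
  have h5 := hH.trace_eq_sum_eigenvalues
  rw [htr1] at h5
  have h6 : ∑ i, hH.eigenvalues i = 1 := by
    have := congrArg Complex.re h5
    simpa using this.symm
  rw [h6, one_mul]

/-- Among the states supported by a projection of rank `n`, the entropy is at most `log n`, with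
equality only for the normalized projection. -/
theorem entropy_le_log_rank {d : ℕ} {p ρ : Matrix (Fin d) (Fin d) ℂ} (hp : p.IsHermitian)
    (hpp : p * p = p) {n : ℝ} (hn : 0 < n) (htr : p.trace = n) (hρ : ρ.PosSemidef)
    (hρ1 : ρ.trace = 1) (hρp : ρ * p = ρ) :
    entropy ρ ≤ Real.log n ∧ (entropy ρ = Real.log n → ρ = (n : ℂ)⁻¹ • p) := by
  have hn' : (n : ℂ) ≠ 0 := by exact_mod_cast hn.ne'
  have hH := hρ.isHermitian
  set μ := hH.eigenvalues with hμ
  set V : Matrix (Fin d) (Fin d) ℂ := (hH.eigenvectorUnitary : Matrix (Fin d) (Fin d) ℂ) with hV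
  have hVV : Vᴴ * V = 1 := Unitary.coe_star_mul_self _
  have hVV' : V * Vᴴ = 1 := Unitary.coe_mul_star_self _
  set D : Matrix (Fin d) (Fin d) ℂ := diagonal fun i => (μ i : ℂ) with hD
  have hρD : ρ = V * D * Vᴴ := hH.spectral_theorem
  set Q := Vᴴ * p * V with hQ
  have hpQ : p = V * Q * Vᴴ := by
    calc p = (V * Vᴴ) * p * (V * Vᴴ) := by rw [hVV']; simp
      _ = _ := by simp only [hQ, Matrix.mul_assoc]
  have hQsd : Q.PosSemidef := by
    have : p.PosSemidef := by
      have := posSemidef_conjTranspose_mul_self p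
      rwa [hp.eq, hpp] at this
    exact this.conjTranspose_mul_mul_same V
  -- In an eigenbasis of `ρ` the support condition says that row `i` of `Q` is a row of the identity
  -- whenever `μ i ≠ 0`.
  have hDQ : D * Q = D := by
    have : D = Vᴴ * ρ * V := by
      rw [hρD]
      calc D = (Vᴴ * V) * D * (Vᴴ * V) := by rw [hVV]; simp
        _ = _ := by simp only [Matrix.mul_assoc]
    calc D * Q = Vᴴ * ρ * (V * Vᴴ) * p * V := by rw [this, hQ]; simp only [Matrix.mul_assoc]
      _ = Vᴴ * (ρ * p) * V := by rw [hVV']; simp only [Matrix.mul_assoc, Matrix.one_mul]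
      _ = D := by rw [hρp, this]
  have hent : ∀ i j, (μ i : ℂ) * Q i j = if i = j then (μ i : ℂ) else 0 := by
    intro i j
    have := congrFun (congrFun hDQ i) j
    rwa [hD, diagonal_mul, diagonal_apply] at this
  have hQtr : ∑ i, (Q i i).re = n := by
    have : Q.trace = n := by
      rw [hQ, Matrix.mul_assoc, trace_mul_comm, Matrix.mul_assoc, hVV', Matrix.mul_one, htr]
    have := congrArg Complex.re this
    simpa [Matrix.trace] using this
  have hμ1 : ∑ i, μ i = 1 := by
    have h5 := hH.trace_eq_sum_eigenvalues
    rw [hρ1] at h5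
    have := congrArg Complex.re h5
    simpa using this.symm
  have hQ0 : ∀ i, 0 ≤ (Q i i).re := fun i => (Complex.le_def.1 (hQsd.diag_nonneg (i := i))).1
  have hQi : ∀ i, (Q i i).im = 0 := fun i => (Complex.le_def.1 (hQsd.diag_nonneg (i := i))).2.symm
  have hone : ∀ i, μ i ≠ 0 → ∀ j, Q i j = if i = j then 1 else 0 := by
    intro i hi j
    have := hent i j
    have hi' : (μ i : ℂ) ≠ 0 := by exact_mod_cast hi
    apply mul_left_cancel₀ hi'
    rw [this]; split_ifs <;> simp
  -- This is the tangent bound with its constant `n⁻¹` weighted by `Q i i`. The weight is `1` if `μ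
  -- i ≠ 0`, and is a nonnegative slack if `μ i = 0`. Since `tr Q = n`, the bounds sum to exactly
  -- `log n`.
  have hle : ∀ i, Real.negMulLog (μ i) ≤ μ i * Real.log n + n⁻¹ * (Q i i).re - μ i ∧
      (Real.negMulLog (μ i) = μ i * Real.log n + n⁻¹ * (Q i i).re - μ i →
        μ i = n⁻¹ * (Q i i).re) := by
    intro i
    rcases (hρ.eigenvalues_nonneg i).eq_or_lt with h0 | h0
    · have h0' : μ i = 0 := h0.symm
      have : 0 ≤ n⁻¹ * (Q i i).re := mul_nonneg (by positivity) (hQ0 i)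
      rw [h0']
      simp only [Real.negMulLog_zero]
      exact ⟨by linarith, fun h => by linarith⟩
    · have h1 : (Q i i).re = 1 := by rw [hone i h0.ne' i]; simp
      rw [h1, mul_one]
      rcases eq_or_ne (μ i) n⁻¹ with h2 | h2
      · rw [h2, negMulLog_inv]
        exact ⟨by linarith, fun _ => rfl⟩
      · have := negMulLog_lt hn h0 h2
        exact ⟨this.le, fun h => absurd h this.ne⟩
  have hsum : ∑ i, (μ i * Real.log n + n⁻¹ * (Q i i).re - μ i) = Real.log n := by
    rw [Finset.sum_sub_distrib, Finset.sum_add_distrib, ← Finset.sum_mul, ← Finset.mul_sum, hQtr,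
      hμ1]
    field_simp
    ring
  rw [entropy_eq_sum hH]
  refine ⟨hsum ▸ Finset.sum_le_sum fun i _ => (hle i).1, fun heq => ?_⟩
  have hall := (Finset.sum_eq_sum_iff_of_le fun i _ => (hle i).1).1 (heq.trans hsum.symm)
  have hμQ : ∀ i, μ i = n⁻¹ * (Q i i).re := fun i => (hle i).2 (hall i (Finset.mem_univ i))
  -- Equality fixes the diagonal of `Q`. Off the diagonal, rows with `μ i ≠ 0` are known already,
  -- and rows with `μ i = 0` have `Q i i = 0` and vanish by positivity.
  have hDe : D = (n : ℂ)⁻¹ • Q := by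
    ext i j
    rw [hD, diagonal_apply, Matrix.smul_apply, smul_eq_mul]
    rcases eq_or_ne i j with rfl | hij
    · rw [if_pos rfl, hμQ i]
      apply Complex.ext <;> simp [hQi, ← Complex.ofReal_inv]
    · rw [if_neg hij]
      rcases eq_or_ne (μ i) 0 with h0 | h0
      · have h1 : (Q i i).re = 0 := by
          have := hμQ i
          rw [h0] at this
          exact (mul_eq_zero.1 this.symm).resolve_left (by positivity)
        have h2 : Q i i = 0 := Complex.ext h1 (hQi i)
        have h3 := posSemidef_col_eq_zero hQsd h2 j
        rw [← hQsd.isHermitian.apply i j, h3]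
        simp
      · rw [hone i h0 j, if_neg hij, mul_zero]
  rw [hρD, hDe, hpQ]
  simp

/-! ### The rotated real part and first-order perturbation -/

/-- The operator `T_A` on Euclidean space given by the matrix `A`. -/
noncomputable abbrev opr (A : Matrix (Fin d) (Fin d) ℂ) :
    EuclideanSpace ℂ (Fin d) →L[ℂ] EuclideanSpace ℂ (Fin d) :=
  Matrix.toEuclideanCLM (n := Fin d) (𝕜 := ℂ) A

theorem opr_rotRe (A : Matrix (Fin d) (Fin d) ℂ) (θ : ℝ) (x : EuclideanSpace ℂ (Fin d)) :
    opr (rotRe A θ) x = (2⁻¹ : ℂ) • (Complex.exp (-(Complex.I * θ)) • opr A x +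
      Complex.exp (Complex.I * θ) • star (opr A) x) := by
  have h : rotRe A θ = (2⁻¹ : ℂ) • (Complex.exp (-(Complex.I * θ)) • A +
      Complex.exp (Complex.I * θ) • star A) := by
    rw [rotRe, realPart_apply_coe, star_smul]
    have : star (Complex.exp (-(Complex.I * θ))) = Complex.exp (Complex.I * θ) := by
      rw [Complex.star_def, ← Complex.exp_conj]
      simp
    rw [this, ← Complex.coe_smul]
    norm_num
  rw [h, opr, map_smul, map_add, map_smul, map_smul, map_star]
  rfl

theorem inner_star_opr (A : Matrix (Fin d) (Fin d) ℂ) (x y : EuclideanSpace ℂ (Fin d)) :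
    inner ℂ x (star (opr A) y) = inner ℂ (opr A x) y := by
  rw [ContinuousLinearMap.star_eq_adjoint, ContinuousLinearMap.adjoint_inner_right]

theorem inner_opr_rotRe (A : Matrix (Fin d) (Fin d) ℂ) (θ : ℝ)
    (x y : EuclideanSpace ℂ (Fin d)) :
    inner ℂ x (opr (rotRe A θ) y) = 2⁻¹ * (Complex.exp (-(Complex.I * θ)) * inner ℂ x (opr A y) +
      Complex.exp (Complex.I * θ) * inner ℂ (opr A x) y) := by
  rw [opr_rotRe, inner_smul_right, inner_add_right, inner_smul_right, inner_smul_right,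
    inner_star_opr]

theorem rotRe_symm (A : Matrix (Fin d) (Fin d) ℂ) (θ : ℝ) (x y : EuclideanSpace ℂ (Fin d)) :
    inner ℂ x (opr (rotRe A θ) y) = inner ℂ (opr (rotRe A θ) x) y := by
  have h : star (rotRe A θ) = rotRe A θ := (realPart _).2
  rw [← inner_star_opr, opr, ← map_star, h]

variable {A : Matrix (Fin d) (Fin d) ℂ} {ψ : Fin d → ℝ → EuclideanSpace ℂ (Fin d)}

theorem IsAnalyticEigenbasis.inner_rotRe_eq_zero (hψ : IsAnalyticEigenbasis A ψ) (θ : ℝ)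
    {j k : Fin d} (hjk : j ≠ k) : inner ℂ (ψ j θ) (opr (rotRe A θ) (ψ k θ)) = 0 := by
  obtain ⟨μ, hμ⟩ := hψ.eigen k θ
  rw [opr, hμ, inner_smul_right, (hψ.orthonormal θ).2 hjk, mul_zero]

/-- First-order perturbation theory: `A` is diagonal on the eigenspaces of `Re (e^{-iθ} A)` in the
analytic eigenbasis. -/
theorem IsAnalyticEigenbasis.inner_opr_eq_zero (hψ : IsAnalyticEigenbasis A ψ) (θ : ℝ)
    {j k : Fin d} (hjk : j ≠ k) {μ : ℝ} (hj : opr (rotRe A θ) (ψ j θ) = (μ : ℂ) • ψ j θ)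
    (hk : opr (rotRe A θ) (ψ k θ) = (μ : ℂ) • ψ k θ) :
    inner ℂ (ψ j θ) (opr A (ψ k θ)) = 0 := by
  have hdj := (hψ.analytic j θ).differentiableAt.hasDerivAt
  have hdk := (hψ.analytic k θ).differentiableAt.hasDerivAt
  set a := deriv (ψ j) θ
  set b := deriv (ψ k) θ
  have hA : ∀ {f : ℝ → EuclideanSpace ℂ (Fin d)} {f'}, HasDerivAt f f' θ →
      HasDerivAt (fun t => opr A (f t)) (opr A f') θ := fun hf =>
    ((opr A).restrictScalars ℝ).hasFDerivAt.comp_hasDerivAt θ hf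
  have horth : inner ℂ (ψ j θ) b + inner ℂ a (ψ k θ) = 0 := by
    have h1 := hdj.inner ℂ hdk
    have h2 : (fun t => inner ℂ (ψ j t) (ψ k t)) = fun _ => (0 : ℂ) :=
      funext fun t => (hψ.orthonormal t).2 hjk
    rw [h2] at h1
    exact h1.unique (hasDerivAt_const θ 0)
  have he : HasDerivAt (fun t : ℝ => Complex.exp (Complex.I * t))
      (Complex.exp (Complex.I * θ) * Complex.I) θ := by
    have : HasDerivAt (fun t : ℝ => Complex.I * (t : ℂ)) (Complex.I * 1) θ :=
      (Complex.ofRealCLM.hasDerivAt (x := θ)).const_mul Complex.I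
    simpa using this.cexp
  have hem : HasDerivAt (fun t : ℝ => Complex.exp (-(Complex.I * t)))
      (Complex.exp (-(Complex.I * θ)) * -Complex.I) θ := by
    have : HasDerivAt (fun t : ℝ => -(Complex.I * (t : ℂ))) (-(Complex.I * 1)) θ :=
      ((Complex.ofRealCLM.hasDerivAt (x := θ)).const_mul Complex.I).neg
    simpa using this.cexp
  -- The function `t ↦ ⟨ψ_j, Re (e^{-it} A) ψ_k⟩` vanishes identically, hence so does its
  -- derivative.
  have h1 := (((hem.mul (hdj.inner ℂ (hA hdk))).add
    (he.mul ((hA hdj).inner ℂ hdk))).const_mul (2⁻¹ : ℂ))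
  have h2 := (h1.congr_of_eventuallyEq (f₁ := fun _ => (0 : ℂ))
    (Filter.Eventually.of_forall fun t => ?_)).unique (hasDerivAt_const θ 0)
  · have h3 := inner_opr_rotRe A θ a (ψ k θ)
    have h4 := inner_opr_rotRe A θ (ψ j θ) b
    have h5 := inner_opr_rotRe A θ (ψ j θ) (ψ k θ)
    rw [hψ.inner_rotRe_eq_zero θ hjk] at h5
    rw [rotRe_symm, hj, inner_smul_left] at h4
    rw [hk, inner_smul_right] at h3
    rw [Complex.conj_ofReal] at h4
    have h6 : Complex.exp (-(Complex.I * θ)) ≠ 0 := Complex.exp_ne_zero _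
    -- The terms with `a` and `b` add up to `μ (⟨a, ψ_k⟩ + ⟨ψ_j, b⟩) = 0` because the eigenvalue is
    -- shared. The derivatives of the two phases remain: they make the two summands of `⟨ψ_j, Re
    -- (e^{-iθ} A) ψ_k⟩` equal, while `h5` makes them opposite.
    have h7 : Complex.exp (-(Complex.I * θ)) * Complex.I * inner ℂ (ψ j θ) (opr A (ψ k θ)) = 0 := by
      linear_combination (-h2 - h3 - h4 + μ * horth - Complex.I * h5)
    simpa [h6] using h7
  · have := inner_opr_rotRe A t (ψ j t) (ψ k t)
    rw [hψ.inner_rotRe_eq_zero t hjk] at this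
    exact this

/-! ### Plane coordinates and weighted averages -/

theorem two_mul_real_inner (w u : ℂ) :
    ((2 * inner ℝ w u : ℝ) : ℂ) = star u * w + u * star w := by
  rw [Complex.inner]
  apply Complex.ext <;> simp <;> ring

/-- For `‖u‖ = 1` the pair `u`, `i u` is a real orthonormal basis of the plane; the endpoints
`x_{K,±}(u)` are given by their coordinates in it. -/
theorem eq_mul_inner {w u : ℂ} (hu : ‖u‖ = 1) :
    w = u * ((inner ℝ w u : ℝ) + Complex.I * (inner ℝ w (Complex.I * u) : ℝ)) := by
  have h : u.re * u.re + u.im * u.im = 1 := by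
    rw [← Complex.normSq_apply, Complex.normSq_eq_norm_sq, hu]; norm_num
  rw [Complex.inner, Complex.inner]
  apply Complex.ext
  · simp; linear_combination (-w.re) * h
  · simp; linear_combination (-w.im) * h

/-- The bound on `f` is asked for only where the weight is nonzero, since in the minimization along
the face it is known only on the lowest level. -/
theorem weighted_min {ι : Type*} [Fintype ι] {p f : ι → ℝ} {m : ℝ} (hp : ∀ k, 0 ≤ p k)
    (h1 : ∑ k, p k = 1) (hm : ∀ k, p k ≠ 0 → m ≤ f k) :
    m ≤ ∑ k, p k * f k ∧ (∑ k, p k * f k = m → ∀ k, f k ≠ m → p k = 0) := by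
  have hs : ∑ k, p k * (f k - m) = ∑ k, p k * f k - m := by
    simp only [mul_sub, Finset.sum_sub_distrib, ← Finset.sum_mul, h1, one_mul]
  have h0 : ∀ k ∈ Finset.univ, 0 ≤ p k * (f k - m) := by
    intro k _
    rcases eq_or_ne (p k) 0 with h | h
    · simp [h]
    · exact mul_nonneg (hp k) (sub_nonneg.2 (hm k h))
  refine ⟨?_, fun he k hk => ?_⟩
  · have := Finset.sum_nonneg h0
    linarith
  · rw [he, sub_self] at hs
    have := (Finset.sum_eq_zero_iff_of_nonneg h0).1 hs k (Finset.mem_univ k)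
    exact (mul_eq_zero.1 this).resolve_right (sub_ne_zero.2 hk)

/-! ### Two-step minimization over states -/

/-- `Re (conj u N)` is diagonal with entries `l`, and `N` is diagonal on its eigenspaces. -/
structure IsSplit (N : Matrix (Fin d) (Fin d) ℂ) (u : ℂ) (l : Fin d → ℝ) : Prop where
  re_eq : star u • N + u • Nᴴ = diagonal fun k => ((2 * l k : ℝ) : ℂ)
  off_diag : ∀ j k, j ≠ k → l j = l k → N j k = 0

variable {N R : Matrix (Fin d) (Fin d) ℂ} {u : ℂ} {l : Fin d → ℝ}

theorem stateSpace_diag_re_nonneg (hR : R ∈ stateSpace d) (k : Fin d) : 0 ≤ (R k k).re :=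
  (Complex.le_def.1 (hR.1.diag_nonneg (i := k))).1

theorem stateSpace_diag_eq (hR : R ∈ stateSpace d) (k : Fin d) : R k k = ((R k k).re : ℂ) :=
  Complex.ext rfl (Complex.le_def.1 (hR.1.diag_nonneg (i := k))).2.symm

theorem stateSpace_sum_diag (hR : R ∈ stateSpace d) : ∑ k, (R k k).re = 1 := by
  have := congrArg Complex.re hR.2
  simpa [Matrix.trace] using this

namespace IsSplit

theorem inner_diag (h : IsSplit N u l) (k : Fin d) : inner ℝ (N k k) u = l k := by
  have h1 := congrFun (congrFun h.re_eq k) k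
  rw [diagonal_apply_eq] at h1
  have h2 := two_mul_real_inner (N k k) u
  have h3 : ((2 * inner ℝ (N k k) u : ℝ) : ℂ) = ((2 * l k : ℝ) : ℂ) := by
    rw [h2, ← h1]; rfl
  have := Complex.ofReal_injective h3
  linarith

theorem inner_trace (h : IsSplit N u l) (hR : R ∈ stateSpace d) :
    inner ℝ (R * N).trace u = ∑ k, (R k k).re * l k := by
  have h1 : ((2 * inner ℝ (R * N).trace u : ℝ) : ℂ) =
      (R * (star u • N + u • Nᴴ)).trace := by
    rw [two_mul_real_inner, ← trace_conjTranspose, conjTranspose_mul, hR.1.isHermitian.eq,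
      trace_mul_comm Nᴴ, Matrix.mul_add, trace_add, Matrix.mul_smul, Matrix.mul_smul, trace_smul,
      trace_smul]
    rfl
  rw [h.re_eq] at h1
  have h2 : (R * diagonal fun k => ((2 * l k : ℝ) : ℂ)).trace =
      ((2 * ∑ k, (R k k).re * l k : ℝ) : ℂ) := by
    rw [Matrix.trace, Finset.mul_sum, Complex.ofReal_sum]
    refine Finset.sum_congr rfl fun k _ => ?_
    rw [diag_apply, mul_diagonal, stateSpace_diag_eq hR k]
    push_cast
    rw [Complex.ofReal_re]
    ring
  have := Complex.ofReal_injective (h1.trans h2)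
  linarith

variable {k₀ : Fin d}

/-- Each off-diagonal product `R j k * N k j` vanishes: if both indices lie on level `m`, the entry
of `N` is zero; otherwise positivity of `R` makes its entry zero. -/
theorem trace_eq (h : IsSplit N u l) (hR : R ∈ stateSpace d) {m : ℝ}
    (h0 : ∀ k, l k ≠ m → R k k = 0) : (R * N).trace = ∑ k, R k k * N k k := by
  rw [Matrix.trace]
  refine Finset.sum_congr rfl fun j _ => ?_
  rw [diag_apply, Matrix.mul_apply]
  refine Finset.sum_eq_single j (fun k _ hkj => ?_) (by simp)
  by_cases hk : l k = m
  · by_cases hj : l j = m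
    · rw [h.off_diag k j hkj (hk.trans hj.symm), mul_zero]
    · have := posSemidef_col_eq_zero hR.1 (h0 j hj) k
      rw [← hR.1.isHermitian.apply j k, this]
      simp
  · rw [posSemidef_col_eq_zero hR.1 (h0 k hk) j, zero_mul]

theorem le_inner_trace (h : IsSplit N u l) (hR : R ∈ stateSpace d) (hmin : ∀ k, l k₀ ≤ l k) :
    l k₀ ≤ inner ℝ (R * N).trace u := by
  rw [h.inner_trace hR]
  exact (weighted_min (stateSpace_diag_re_nonneg hR) (stateSpace_sum_diag hR)
    fun k _ => hmin k).1

theorem diag_eq_zero (h : IsSplit N u l) (hR : R ∈ stateSpace d) (hmin : ∀ k, l k₀ ≤ l k)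
    (he : inner ℝ (R * N).trace u = l k₀) (k : Fin d) (hk : l k ≠ l k₀) : R k k = 0 := by
  rw [h.inner_trace hR] at he
  rw [stateSpace_diag_eq hR k, (weighted_min (stateSpace_diag_re_nonneg hR)
    (stateSpace_sum_diag hR) fun k _ => hmin k).2 he k hk, Complex.ofReal_zero]

theorem inner_trace_eq (h : IsSplit N u l) (hR : R ∈ stateSpace d) {m : ℝ}
    (h0 : ∀ k, l k ≠ m → R k k = 0) (v : ℂ) :
    inner ℝ (R * N).trace v = ∑ k, (R k k).re * inner ℝ (N k k) v := by
  rw [h.trace_eq hR h0, sum_inner]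
  refine Finset.sum_congr rfl fun k _ => ?_
  rw [stateSpace_diag_eq hR k, ← smul_eq_mul, Complex.coe_smul, real_inner_smul_left]
  simp

/-- The hypothesis `he` confines `R` to the lowest level of `l`, where the `v`-coordinate of the
trace is an average of those of the `N k k`. -/
theorem face_min (h : IsSplit N u l) (hR : R ∈ stateSpace d) (hmin : ∀ k, l k₀ ≤ l k) {v : ℂ}
    (hmin' : ∀ k, l k = l k₀ → inner ℝ (N k₀ k₀) v ≤ inner ℝ (N k k) v)
    (he : inner ℝ (R * N).trace u = l k₀) :
    inner ℝ (N k₀ k₀) v ≤ inner ℝ (R * N).trace v ∧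
      (inner ℝ (R * N).trace v = inner ℝ (N k₀ k₀) v → ∀ k,
        inner ℝ (N k k) v ≠ inner ℝ (N k₀ k₀) v → R k k = 0) := by
  have h0 := h.diag_eq_zero hR hmin he
  rw [h.inner_trace_eq hR h0]
  have := weighted_min (stateSpace_diag_re_nonneg hR) (stateSpace_sum_diag hR)
    (f := fun k => inner ℝ (N k k) v) (m := inner ℝ (N k₀ k₀) v) fun k hk => hmin' k <| by
      by_contra hl
      exact hk (by rw [h0 k hl, Complex.zero_re])
  refine ⟨this.1, fun e k hk => ?_⟩
  rw [stateSpace_diag_eq hR k, this.2 e k hk, Complex.ofReal_zero]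

theorem exists_lex_min (hd : 0 < d) (l τ : Fin d → ℝ) :
    ∃ k₀, (∀ k, l k₀ ≤ l k) ∧ ∀ k, l k = l k₀ → τ k₀ ≤ τ k := by
  have : Nonempty (Fin d) := ⟨⟨0, hd⟩⟩
  obtain ⟨k₁, h₁⟩ := Finite.exists_min l
  obtain ⟨k₀, h₀, h₂⟩ := Finset.exists_min_image (Finset.univ.filter fun k => l k = l k₁) τ
    ⟨k₁, by simp⟩
  have h₀' : l k₀ = l k₁ := by simpa using h₀
  exact ⟨k₀, fun k => h₀' ▸ h₁ k, fun k hk => h₂ k (by simpa using hk.trans h₀')⟩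

/-- The endpoint of the exposed face in direction `v = s i u` is a diagonal entry of `N`. -/
theorem endpoint (h : IsSplit N u l) (hmin : ∀ k, l k₀ ≤ l k) {v : ℂ}
    (hmin' : ∀ k, l k = l k₀ → inner ℝ (N k₀ k₀) v ≤ inner ℝ (N k k) v) {W : Set ℂ}
    (hW : ∀ w ∈ W, ∃ R ∈ stateSpace d, (R * N).trace = w) (hNW : N k₀ k₀ ∈ W) :
    supportFun W u = inner ℝ (N k₀ k₀) u ∧
      supportFun (exposedFace W u) v = inner ℝ (N k₀ k₀) v := by
  have hle : ∀ w ∈ W, inner ℝ (N k₀ k₀) u ≤ inner ℝ w u := by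
    intro w hw
    obtain ⟨R, hR, rfl⟩ := hW w hw
    rw [h.inner_diag]
    exact h.le_inner_trace hR hmin
  constructor
  · refine IsLeast.csInf_eq ⟨⟨_, hNW, rfl⟩, ?_⟩
    rintro _ ⟨w, hw, rfl⟩
    exact hle w hw
  · refine IsLeast.csInf_eq ⟨⟨_, ⟨hNW, hle⟩, rfl⟩, ?_⟩
    rintro _ ⟨w, ⟨hw, hw'⟩, rfl⟩
    obtain ⟨R, hR, rfl⟩ := hW w hw
    refine (h.face_min hR hmin hmin' ?_).1
    rw [← h.inner_diag]
    exact le_antisymm (hw' _ hNW) (hle _ hw)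

/-- An endpoint of the exposed face is a diagonal entry of `N`, and the states representing it
live on the indices of the diagonal entries equal to it. -/
theorem exists_endpoint (hd : 0 < d) (hu : ‖u‖ = 1) (h : IsSplit N u l) {W : Set ℂ}
    (hW : ∀ w ∈ W, ∃ R ∈ stateSpace d, (R * N).trace = w) (hNW : ∀ k, N k k ∈ W) {z : ℂ}
    (hz : z = xPlus W u ∨ z = xMinus W u) :
    ∃ k₀, N k₀ k₀ = z ∧
      ∀ R ∈ stateSpace d, (R * N).trace = z → ∀ k, N k k ≠ z → R k k = 0 := by
  -- The sign `s = ±1` treats both endpoints at once.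
  obtain ⟨s, hs, hz⟩ : ∃ s : ℝ, s * s = 1 ∧ z = u * ((supportFun W u : ℂ) +
      Complex.I * (s * supportFun (exposedFace W u) ((s : ℂ) * (Complex.I * u)) : ℝ)) := by
    rcases hz with hz | hz
    · exact ⟨1, by norm_num, by rw [hz, xPlus]; simp⟩
    · exact ⟨-1, by norm_num, by rw [hz, xMinus]; simp [sub_eq_add_neg]⟩
  have hin : ∀ w, inner ℝ w ((s : ℂ) * (Complex.I * u)) = s * inner ℝ w (Complex.I * u) := by
    intro w
    rw [← smul_eq_mul, Complex.coe_smul, real_inner_smul_right]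
  obtain ⟨k₀, hmin, hmin'⟩ := exists_lex_min hd l
    fun k => inner ℝ (N k k) ((s : ℂ) * (Complex.I * u))
  obtain ⟨h1, h2⟩ := h.endpoint hmin hmin' hW (hNW k₀)
  have hzN : N k₀ k₀ = z := by
    rw [hz, h1, h2, hin, ← mul_assoc, hs, one_mul, ← eq_mul_inner hu]
  refine ⟨k₀, hzN, fun R hR hRz k hk => ?_⟩
  have he : inner ℝ (R * N).trace u = l k₀ := by rw [hRz, ← hzN, h.inner_diag]
  by_cases hl : l k = l k₀
  -- An index on the lowest level with the same coordinate along the face shares both plane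
  -- coordinates with `z`, so its diagonal entry is `z`.
  · refine (h.face_min hR hmin hmin' he).2 (by rw [hRz, hzN]) k fun e => hk ?_
    rw [hin, hin] at e
    have hs0 : s ≠ 0 := by rintro rfl; simp at hs
    rw [← hzN, eq_mul_inner (w := N k k) hu, mul_left_cancel₀ hs0 e, h.inner_diag, hl,
      ← h.inner_diag, ← eq_mul_inner hu]
  · exact h.diag_eq_zero hR hmin he k hl

end IsSplit

/-! ### Passage to the eigenbasis -/

/-- The matrix whose columns are the vectors `ψ_k(θ)`. -/
def colMat (ψ : Fin d → ℝ → EuclideanSpace ℂ (Fin d)) (θ : ℝ) : Matrix (Fin d) (Fin d) ℂ :=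
  Matrix.of fun i k => (ψ k θ).ofLp i

/-- The matrix of `A` in the basis `ψ_k(θ)`. -/
def basisMat (A : Matrix (Fin d) (Fin d) ℂ) (ψ : Fin d → ℝ → EuclideanSpace ℂ (Fin d)) (θ : ℝ) :
    Matrix (Fin d) (Fin d) ℂ :=
  (colMat ψ θ)ᴴ * A * colMat ψ θ

variable {θ : ℝ}

theorem colMat_conjTranspose_mulVec (x : EuclideanSpace ℂ (Fin d)) (k : Fin d) :
    ((colMat ψ θ)ᴴ *ᵥ x.ofLp) k = inner ℂ (ψ k θ) x := by
  rw [EuclideanSpace.inner_eq_star_dotProduct, dotProduct_comm]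
  rfl

theorem colMat_mulVec (c : Fin d → ℂ) :
    WithLp.toLp 2 (colMat ψ θ *ᵥ c) = ∑ k, c k • ψ k θ := by
  ext i
  simp [colMat, mulVec, dotProduct, mul_comm]

theorem basisMat_apply (j k : Fin d) :
    basisMat A ψ θ j k = inner ℂ (ψ j θ) (opr A (ψ k θ)) := by
  rw [← colMat_conjTranspose_mulVec, ofLp_toEuclideanCLM, basisMat, Matrix.mul_assoc]
  rfl

theorem zCurve_eq (k : Fin d) : zCurve A ψ k θ = basisMat A ψ θ k k := (basisMat_apply k k).symm

theorem IsAnalyticEigenbasis.colMat_star_mul (hψ : IsAnalyticEigenbasis A ψ) :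
    (colMat ψ θ)ᴴ * colMat ψ θ = 1 := by
  ext j k
  have h := orthonormal_iff_ite.1 (hψ.orthonormal θ) j k
  rw [← colMat_conjTranspose_mulVec] at h
  rw [one_apply, ← h]
  rfl

theorem IsAnalyticEigenbasis.colMat_mul_star (hψ : IsAnalyticEigenbasis A ψ) :
    colMat ψ θ * (colMat ψ θ)ᴴ = 1 := mul_eq_one_comm.1 hψ.colMat_star_mul

/-- Orthonormality and the eigenvalue equations at `θ` give `re_eq`; only `off_diag` needs the curve
around `θ`, through its derivative. -/
theorem IsAnalyticEigenbasis.exists_isSplit (hψ : IsAnalyticEigenbasis A ψ) (θ : ℝ) :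
    ∃ l, IsSplit (basisMat A ψ θ) (Complex.exp (Complex.I * θ)) l := by
  choose l hl using fun k => hψ.eigen k θ
  refine ⟨l, ?_, fun j k hjk hljk => ?_⟩
  · ext j k
    have h1 := inner_opr_rotRe A θ (ψ j θ) (ψ k θ)
    rw [opr, hl k, inner_smul_right, orthonormal_iff_ite.1 (hψ.orthonormal θ) j k] at h1
    rw [Matrix.add_apply, Matrix.smul_apply, Matrix.smul_apply, conjTranspose_apply,
      basisMat_apply, basisMat_apply, Complex.star_def, inner_conj_symm,
      ← Complex.exp_conj, diagonal_apply, smul_eq_mul, smul_eq_mul]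
    have h2 : (starRingEnd ℂ) (Complex.I * θ) = -(Complex.I * θ) := by simp
    rw [h2]
    rcases eq_or_ne j k with rfl | hjk
    · simp only [if_true] at h1 ⊢
      push_cast
      linear_combination (-2) * h1
    · simp only [if_neg hjk] at h1 ⊢
      linear_combination (-2) * h1
  · rw [basisMat_apply]
    exact hψ.inner_opr_eq_zero θ hjk (hljk ▸ hl j) (hl k)

theorem trace_basisMat (hψ : IsAnalyticEigenbasis A ψ) (ρ : Matrix (Fin d) (Fin d) ℂ) :
    ((colMat ψ θ)ᴴ * ρ * colMat ψ θ * basisMat A ψ θ).trace = (ρ * A).trace := by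
  set U := colMat ψ θ
  calc (Uᴴ * ρ * U * (Uᴴ * A * U)).trace = (Uᴴ * (ρ * (U * Uᴴ) * A * U)).trace := by
        simp only [Matrix.mul_assoc]
    _ = _ := by
      rw [hψ.colMat_mul_star, trace_mul_comm, Matrix.mul_one, Matrix.mul_assoc,
        hψ.colMat_mul_star, Matrix.mul_one]

theorem conj_colMat_mem (hψ : IsAnalyticEigenbasis A ψ) {ρ : Matrix (Fin d) (Fin d) ℂ}
    (hρ : ρ ∈ stateSpace d) : (colMat ψ θ)ᴴ * ρ * colMat ψ θ ∈ stateSpace d :=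
  ⟨hρ.1.conjTranspose_mul_mul_same _, by
    rw [Matrix.mul_assoc, trace_mul_comm, Matrix.mul_assoc, hψ.colMat_mul_star, Matrix.mul_one,
      hρ.2]⟩

/-- The pure state of a vector. -/
def pureState (x : EuclideanSpace ℂ (Fin d)) : Matrix (Fin d) (Fin d) ℂ :=
  vecMulVec x.ofLp (star x.ofLp)

theorem pureState_mem {x : EuclideanSpace ℂ (Fin d)} (hx : x ∈ Metric.sphere 0 1) :
    pureState x ∈ stateSpace d := by
  refine ⟨posSemidef_vecMulVec_self_star _, ?_⟩
  rw [pureState, trace_vecMulVec, ← EuclideanSpace.inner_eq_star_dotProduct,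
    inner_self_eq_norm_sq_to_K, mem_sphere_zero_iff_norm.1 hx]
  simp

theorem trace_pureState_mul (x : EuclideanSpace ℂ (Fin d)) :
    (pureState x * A).trace = nrMap A x := by
  rw [nrMap, EuclideanSpace.inner_eq_star_dotProduct, pureState, trace_mul_comm, mul_vecMulVec,
    trace_vecMulVec]
  rfl

theorem conj_pureState_apply (x : EuclideanSpace ℂ (Fin d)) (j k : Fin d) :
    ((colMat ψ θ)ᴴ * pureState x * colMat ψ θ) j k =
      inner ℂ (ψ j θ) x * star (inner ℂ (ψ k θ) x) := by
  rw [pureState, mul_vecMulVec, vecMulVec_mul, vecMulVec_apply, colMat_conjTranspose_mulVec]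
  congr 1
  rw [← colMat_conjTranspose_mulVec]
  have h := star_mulVec (colMat ψ θ)ᴴ x.ofLp
  rw [conjTranspose_conjTranspose] at h
  exact (congrFun h k).symm

/-- Points of the numerical range come from pure states. This and `basisMat_diag_mem` suffice to
locate the endpoints, so convexity of the numerical range is not needed. -/
theorem mem_numRange {w : ℂ} (hψ : IsAnalyticEigenbasis A ψ) (hw : w ∈ numRange A) :
    ∃ R ∈ stateSpace d, (R * basisMat A ψ θ).trace = w := by
  obtain ⟨x, hx, rfl⟩ := hw
  exact ⟨_, conj_colMat_mem hψ (pureState_mem hx), by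
    rw [trace_basisMat hψ, trace_pureState_mul]⟩

theorem basisMat_diag_mem (hψ : IsAnalyticEigenbasis A ψ) (k : Fin d) :
    basisMat A ψ θ k k ∈ numRange A :=
  ⟨ψ k θ, mem_sphere_zero_iff_norm.2 ((hψ.orthonormal θ).1 k), zCurve_eq k⟩

/-! ### The projection onto the span and the states it supports -/

open Classical in
/-- The diagonal `0-1` matrix of the index set of `z`. -/
noncomputable def indMat (A : Matrix (Fin d) (Fin d) ℂ) (ψ : Fin d → ℝ → EuclideanSpace ℂ (Fin d))
    (z : ℂ) (θ : ℝ) : Matrix (Fin d) (Fin d) ℂ :=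
  diagonal fun k => if basisMat A ψ θ k k = z then 1 else 0

theorem projMat_eq (hψ : IsAnalyticEigenbasis A ψ) (z : ℂ) (θ : ℝ) :
    projMat A ψ z θ = colMat ψ θ * indMat A ψ z θ * (colMat ψ θ)ᴴ := by
  classical
  rw [projMat, StarAlgEquiv.symm_apply_eq]
  ext1 x
  refine (Submodule.eq_starProjection_of_mem_of_inner_eq_zero ?_ fun w hw => ?_)
  · have : opr (colMat ψ θ * indMat A ψ z θ * (colMat ψ θ)ᴴ) x =
        WithLp.toLp 2 (colMat ψ θ *ᵥ (indMat A ψ z θ *ᵥ ((colMat ψ θ)ᴴ *ᵥ x.ofLp))) := by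
      rw [mulVec_mulVec, mulVec_mulVec, ← toEuclideanCLM_toLp]
    rw [this, colMat_mulVec]
    refine Submodule.sum_mem _ fun k _ => ?_
    rw [indMat, mulVec_diagonal]
    split_ifs with hk
    · exact Submodule.smul_mem _ _ (Submodule.subset_span ⟨k, by
        rw [indexSet, Set.mem_ofPred_eq, zCurve_eq, hk], rfl⟩)
    · simp
  · refine Submodule.span_induction (p := fun w _ => inner ℂ
      (x - opr (colMat ψ θ * indMat A ψ z θ * (colMat ψ θ)ᴴ) x) w = 0) ?_ (by simp)
      (fun a b _ _ ha hb => by rw [inner_add_right, ha, hb, add_zero])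
      (fun c a _ ha => by rw [inner_smul_right, ha, mul_zero]) hw
    rintro _ ⟨k, hk, rfl⟩
    rw [indexSet, Set.mem_ofPred_eq, zCurve_eq] at hk
    rw [inner_eq_zero_symm, ← colMat_conjTranspose_mulVec, WithLp.ofLp_sub, mulVec_sub,
      ofLp_toEuclideanCLM, mulVec_mulVec, ← Matrix.mul_assoc, ← Matrix.mul_assoc,
      hψ.colMat_star_mul, Matrix.one_mul, ← mulVec_mulVec, Pi.sub_apply, indMat,
      mulVec_diagonal, if_pos hk.symm, one_mul, sub_self]

theorem mem_eigSpan_iff (hψ : IsAnalyticEigenbasis A ψ) {z : ℂ} {x : EuclideanSpace ℂ (Fin d)} :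
    x ∈ eigSpan A ψ z θ ↔ ∀ k, basisMat A ψ θ k k ≠ z → inner ℂ (ψ k θ) x = 0 := by
  classical
  constructor
  · intro hx k hk
    refine Submodule.span_induction (p := fun w _ => inner ℂ (ψ k θ) w = 0) ?_ (by simp)
      (fun a b _ _ ha hb => by rw [inner_add_right, ha, hb, add_zero])
      (fun c a _ ha => by rw [inner_smul_right, ha, mul_zero]) hx
    rintro _ ⟨j, hj, rfl⟩
    rw [indexSet, Set.mem_ofPred_eq, zCurve_eq] at hj
    exact (hψ.orthonormal θ).2 fun e => hk (e ▸ hj.symm)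
  · intro h
    have hx : x = ∑ k, inner ℂ (ψ k θ) x • ψ k θ := by
      have := colMat_mulVec (ψ := ψ) (θ := θ) ((colMat ψ θ)ᴴ *ᵥ x.ofLp)
      rw [mulVec_mulVec, hψ.colMat_mul_star, one_mulVec] at this
      simpa only [colMat_conjTranspose_mulVec] using this
    rw [hx]
    refine Submodule.sum_mem _ fun k _ => ?_
    by_cases hk : basisMat A ψ θ k k = z
    · exact Submodule.smul_mem _ _ (Submodule.subset_span ⟨k, by
        rw [indexSet, Set.mem_ofPred_eq, zCurve_eq, hk], rfl⟩)
    · rw [h k hk, zero_smul]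
      exact Submodule.zero_mem _

theorem projMat_isHermitian (hψ : IsAnalyticEigenbasis A ψ) (z : ℂ) (θ : ℝ) :
    (projMat A ψ z θ).IsHermitian := by
  classical
  have h : (indMat A ψ z θ)ᴴ = indMat A ψ z θ := by
    rw [indMat, diagonal_conjTranspose]
    congr 1
    ext k
    rw [Pi.star_apply]
    split_ifs <;> simp
  rw [IsHermitian, projMat_eq hψ, conjTranspose_mul, conjTranspose_mul, h,
    conjTranspose_conjTranspose, Matrix.mul_assoc]

theorem projMat_mul_self (z : ℂ) (θ : ℝ) :
    projMat A ψ z θ * projMat A ψ z θ = projMat A ψ z θ := by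
  rw [projMat, ← map_mul, (Submodule.isIdempotentElem_starProjection _).eq]

theorem exists_trace_projMat (hψ : IsAnalyticEigenbasis A ψ) {z : ℂ} {k₀ : Fin d}
    (h₀ : basisMat A ψ θ k₀ k₀ = z) : ∃ n : ℝ, 0 < n ∧ (projMat A ψ z θ).trace = n := by
  classical
  refine ⟨((Finset.univ.filter fun k => basisMat A ψ θ k k = z).card : ℝ), ?_, ?_⟩
  · exact_mod_cast Finset.card_pos.2 ⟨k₀, by simpa using h₀⟩
  · rw [projMat_eq hψ, trace_mul_comm, ← Matrix.mul_assoc, hψ.colMat_star_mul, Matrix.one_mul,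
      indMat, trace_diagonal, Finset.sum_boole]
    simp

theorem trace_projMat_mul (hψ : IsAnalyticEigenbasis A ψ) (z : ℂ) (θ : ℝ) :
    (projMat A ψ z θ * A).trace = (projMat A ψ z θ).trace * z := by
  classical
  have h1 : (projMat A ψ z θ).trace = (indMat A ψ z θ).trace := by
    rw [projMat_eq hψ, trace_mul_comm, ← Matrix.mul_assoc, hψ.colMat_star_mul, Matrix.one_mul]
  have h2 : (projMat A ψ z θ * A).trace = (indMat A ψ z θ * basisMat A ψ θ).trace := by
    rw [projMat_eq hψ, basisMat, Matrix.mul_assoc, Matrix.mul_assoc, trace_mul_comm]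
    simp only [Matrix.mul_assoc]
  rw [h1, h2, indMat, trace_diagonal, Matrix.trace, Finset.sum_mul]
  refine Finset.sum_congr rfl fun k _ => ?_
  rw [diag_apply, diagonal_mul]
  split_ifs with hk <;> simp [hk]

/-- In the eigenbasis the projection is a diagonal 0-1 matrix, and the columns it deletes already
vanish by positivity. -/
theorem mul_projMat_eq (hψ : IsAnalyticEigenbasis A ψ) {z : ℂ} {ρ : Matrix (Fin d) (Fin d) ℂ}
    (hρ : ρ ∈ stateSpace d) (h : ∀ k, basisMat A ψ θ k k ≠ z →
      ((colMat ψ θ)ᴴ * ρ * colMat ψ θ) k k = 0) : ρ * projMat A ψ z θ = ρ := by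
  classical
  set U := colMat ψ θ with hU
  have hR : (Uᴴ * ρ * U).PosSemidef := hρ.1.conjTranspose_mul_mul_same _
  have h1 : Uᴴ * ρ * U * indMat A ψ z θ = Uᴴ * ρ * U := by
    ext j k
    rw [indMat, mul_diagonal]
    split_ifs with hk
    · rw [mul_one]
    · rw [mul_zero, posSemidef_col_eq_zero hR (h k hk) j]
  have hUU : U * Uᴴ = 1 := hψ.colMat_mul_star
  calc ρ * projMat A ψ z θ = (U * Uᴴ) * ρ * (U * indMat A ψ z θ * Uᴴ) := by
        rw [projMat_eq hψ, hUU, Matrix.one_mul]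
    _ = U * (Uᴴ * ρ * U * indMat A ψ z θ) * Uᴴ := by simp only [Matrix.mul_assoc]
    _ = (U * Uᴴ) * ρ * (U * Uᴴ) := by rw [h1]; simp only [Matrix.mul_assoc]
    _ = ρ := by rw [hUU, Matrix.one_mul, Matrix.mul_one]

theorem nrMap_eq_of_mem_eigSpan (hψ : IsAnalyticEigenbasis A ψ) {z : ℂ}
    {x : EuclideanSpace ℂ (Fin d)} (hx : x ∈ Metric.sphere 0 1) (hxz : x ∈ eigSpan A ψ z θ) :
    nrMap A x = z := by
  have h0 := (mem_eigSpan_iff hψ).1 hxz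
  have h1 : pureState x * projMat A ψ z θ = pureState x :=
    mul_projMat_eq hψ (pureState_mem hx) fun k hk => by
      rw [conj_pureState_apply, h0 k hk, zero_mul]
  obtain ⟨l, hl⟩ := hψ.exists_isSplit θ
  have hR := conj_colMat_mem (θ := θ) hψ (pureState_mem hx)
  -- All indices with `N k k = z` lie on the single level `⟨z, u⟩` of `l`, so `trace_eq` applies for
  -- any `z`, endpoint or not.
  have h2 : ∀ k, l k ≠ inner ℝ z (Complex.exp (Complex.I * θ)) →
      ((colMat ψ θ)ᴴ * pureState x * colMat ψ θ) k k = 0 := fun k hk => by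
    rw [conj_pureState_apply, h0 k fun e => hk (by rw [← hl.inner_diag, e]), zero_mul]
  rw [← trace_pureState_mul, ← trace_basisMat hψ (θ := θ), hl.trace_eq hR h2]
  have h3 : ∀ k, ((colMat ψ θ)ᴴ * pureState x * colMat ψ θ) k k * basisMat A ψ θ k k =
      ((colMat ψ θ)ᴴ * pureState x * colMat ψ θ) k k * z := fun k => by
    by_cases hk : basisMat A ψ θ k k = z
    · rw [hk]
    · rw [conj_pureState_apply, h0 k hk, zero_mul, zero_mul, zero_mul]
  rw [Finset.sum_congr rfl fun k _ => h3 k, ← Finset.sum_mul]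
  have h4 := hR.2
  rw [Matrix.trace] at h4
  simp only [diag_apply] at h4
  rw [h4, one_mul]

theorem smul_projMat_mem (hψ : IsAnalyticEigenbasis A ψ) {z : ℂ} {n : ℝ} (hn : 0 < n)
    (htr : (projMat A ψ z θ).trace = n) : (n : ℂ)⁻¹ • projMat A ψ z θ ∈ stateFiber A z := by
  have hn' : (n : ℂ) ≠ 0 := by exact_mod_cast hn.ne'
  have hp : (projMat A ψ z θ).PosSemidef := by
    have := posSemidef_conjTranspose_mul_self (projMat A ψ z θ)
    rwa [(projMat_isHermitian hψ z θ).eq, projMat_mul_self] at this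
  refine ⟨⟨hp.smul ?_, ?_⟩, ?_⟩
  · rw [← Complex.ofReal_inv]
    exact_mod_cast (inv_pos.2 hn).le
  · rw [trace_smul, htr, smul_eq_mul, inv_mul_cancel₀ hn']
  · rw [Matrix.smul_mul, trace_smul, trace_projMat_mul hψ, htr, smul_eq_mul,
      inv_mul_cancel_left₀ hn']

end MaxEntNR

/-! ### The preimage and the entropy maximizer at an endpoint -/

open MaxEntNR

theorem mainTheorem9 (d : ℕ) (hd : 0 < d) (A : Matrix (Fin d) (Fin d) ℂ)
    (ψ : Fin d → ℝ → EuclideanSpace ℂ (Fin d)) (hψ : MaxEntNR.IsAnalyticEigenbasis A ψ)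
    (θ : ℝ) (z : ℂ)
    (hz : z = MaxEntNR.xPlus (MaxEntNR.numRange A) (Complex.exp (Complex.I * θ)) ∨
      z = MaxEntNR.xMinus (MaxEntNR.numRange A) (Complex.exp (Complex.I * θ))) :
    MaxEntNR.nrInv A z =
        Metric.sphere 0 1 ∩ (MaxEntNR.eigSpan A ψ z θ : Set (EuclideanSpace ℂ (Fin d))) ∧
      MaxEntNR.maxEntSet A z = {MaxEntNR.maxEntMap A z} ∧
      MaxEntNR.maxEntMap A z =
        (MaxEntNR.projMat A ψ z θ).trace⁻¹ • MaxEntNR.projMat A ψ z θ := by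
  obtain ⟨l, hl⟩ := hψ.exists_isSplit θ
  have hu : ‖Complex.exp (Complex.I * θ)‖ = 1 := by
    rw [mul_comm, Complex.norm_exp_ofReal_mul_I]
  obtain ⟨k₀, hk₀, hsupp⟩ := hl.exists_endpoint hd hu (fun w hw => mem_numRange hψ hw)
    (basisMat_diag_mem hψ) hz
  obtain ⟨n, hn, htr⟩ := exists_trace_projMat hψ hk₀
  have hsupp' : ∀ ρ ∈ stateFiber A z, ∀ k, basisMat A ψ θ k k ≠ z →
      ((colMat ψ θ).conjTranspose * ρ * colMat ψ θ) k k = 0 := fun ρ hρ =>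
    hsupp _ (conj_colMat_mem hψ hρ.1) (by rw [trace_basisMat hψ, hρ.2])
  have hH := projMat_isHermitian hψ z θ
  have hS := entropy_smul_projection hH (projMat_mul_self z θ) hn htr
  have hle : ∀ ρ ∈ stateFiber A z, entropy ρ ≤ Real.log n ∧
      (entropy ρ = Real.log n → ρ = (n : ℂ)⁻¹ • projMat A ψ z θ) := fun ρ hρ =>
    entropy_le_log_rank hH (projMat_mul_self z θ) hn htr hρ.1.1 hρ.1.2
      (mul_projMat_eq hψ hρ.1 (hsupp' ρ hρ))
  have hmem := smul_projMat_mem hψ hn htr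
  have hset : maxEntSet A z = {(n : ℂ)⁻¹ • projMat A ψ z θ} := by
    ext ρ
    rw [Set.mem_singleton_iff]
    constructor
    · rintro ⟨hρ, hmax⟩
      exact (hle ρ hρ).2 (le_antisymm (hle ρ hρ).1 (hS ▸ hmax _ hmem))
    · rintro rfl
      exact ⟨hmem, fun σ hσ => hS ▸ (hle σ hσ).1⟩
  have hmap : maxEntMap A z = (n : ℂ)⁻¹ • projMat A ψ z θ := by
    have : maxEntMap A z ∈ maxEntSet A z :=
      Classical.epsilon_spec (p := fun ρ => ρ ∈ maxEntSet A z) ⟨_, hset.symm ▸ Set.mem_singleton _⟩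
    rwa [hset] at this
  refine ⟨?_, by rw [hset, hmap], by rw [hmap, htr]⟩
  ext x
  refine and_congr_right fun hx => ⟨fun hxz => ?_, nrMap_eq_of_mem_eigSpan hψ hx⟩
  refine (mem_eigSpan_iff hψ).2 fun k hk => ?_
  -- The `k`-th diagonal entry of the pure state in the eigenbasis is `|⟨ψ_k, x⟩|²`.
  have := hsupp' (pureState x) ⟨pureState_mem hx, by rw [trace_pureState_mul, hxz]⟩ k hk
  rw [conj_pureState_apply] at this
  exact (mul_eq_zero.1 this).elim id star_eq_zero.1
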